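/- Let $\mathbb K=\mathbb R$ or $\mathbb C$ and let $\mathcal A$ be a $3$-dimensional $\mathbb K$-vector space with two Lie brackets $[\cdot,\cdot]$ and $[\cdot,\cdot]_1$. Assume that $[\cdot,\cdot]$ is not unimodular (i.e. $\operatorname{tr}[a,\cdot]\neq 0$ for some $a$), that $[\cdot,\cdot]_1$ is unimodular and non-zero, and that the unimodular ideal $I=\{a\in\mathcal A : \operatorname{tr}[a,\cdot]=0\}$ of $[\cdot,\cdot]$ is an abelian ideal for $[\cdot,\cdot]_1$. Let $\Lambda,\Lambda_1$ be the Lie–Poisson structures on $\mathcal A^*$ of $[\cdot,\cdot]$ and $[\cdot,\cdot]_1$, that is $\Lambda(a,b)=[a,b]$ and $\Lambda_1(a,b)=[a,b]_1$ for $a,b\in\mathcal A$ regarded as linear functions on $\mathcal A^*$. The pair $(\Lambda,\Lambda_1)$ is called generic at $p\in\mathcal A^*$ if $(s\Lambda+t\Lambda_1)(p)\neq 0$ for all $(s,t)\in\mathbb C^2\setminus\{0\}$ (after complexification if $\mathbb K=\mathbb R$), and flat at $p$ if in some coordinates around $p$ (smooth if $\mathbb K=\mathbb R$, holomorphic if $\mathbb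 K=\mathbb C$) both $\Lambda$ and $\Lambda_1$ have constant coefficients. The pair is generic if it is generic at some point, and flat if it is flat at every point where it is generic. Then for every $u\in\mathcal A\setminus I$ the following are equivalent: (i) $(\Lambda,\Lambda_1)$ is generic and not flat; (ii) some eigenvector of $[u,\cdot]_1|_I$ is not an eigenvector of $[u,\cdot]|_I$, where, if $\mathbb K=\mathbb R$, eigenvectors are taken in the complexification $I\otimes_{\mathbb R}\mathbb C$ and eigenvalues may be complex. -/

import Mathlib

open scoped ContDiff TensorProduct

/-- A Lie bracket on the `𝕜`-module `A`, as a bundled bilinear map (two different brackets are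
considered on the same space, so the type class `LieRing` is not used). -/
structure LieBracket (𝕜 A : Type*) [CommRing 𝕜] [AddCommGroup A] [Module 𝕜 A] where
  /-- the bilinear map `(x, y) ↦ [x, y]`; in particular `ad x = [x, ·]` is a linear endomorphism -/
  ad : A →ₗ[𝕜] A →ₗ[𝕜] A
  self_eq_zero : ∀ x, ad x x = 0
  jacobi : ∀ x y z, ad x (ad y z) + ad y (ad z x) + ad z (ad x y) = 0

namespace LieBracket

section Algebra

variable {𝕜 A : Type*} [CommRing 𝕜] [AddCommGroup A] [Module 𝕜 A]

/-- `tr [a, ·] = 0` for all `a`. -/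
def IsUnimodular (L : LieBracket 𝕜 A) : Prop :=
  ∀ a, LinearMap.trace 𝕜 A (L.ad a) = 0

/-- The set `{a | tr [a, ·] = 0}`. -/
noncomputable def unimodularIdeal (L : LieBracket 𝕜 A) : Submodule 𝕜 A :=
  LinearMap.ker (LinearMap.trace 𝕜 A ∘ₗ L.ad)

/-- `J` is an ideal for the bracket `L`. -/
def IsIdeal (L : LieBracket 𝕜 A) (J : Submodule 𝕜 A) : Prop :=
  ∀ a, ∀ x ∈ J, L.ad a x ∈ J

/-- The bracket `L` vanishes on `J`. -/
def IsAbelianOn (L : LieBracket 𝕜 A) (J : Submodule 𝕜 A) : Prop :=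
  ∀ x ∈ J, ∀ y ∈ J, L.ad x y = 0

/-- The restriction of `[u, ·]` to an ideal `J`. -/
def adRestrict (L : LieBracket 𝕜 A) {J : Submodule 𝕜 A} (hJ : L.IsIdeal J) (u : A) :
    Module.End 𝕜 J :=
  (L.ad u).restrict (hJ u)

theorem skew (L : LieBracket 𝕜 A) (x y : A) : L.ad x y = -L.ad y x := by
  have h := L.self_eq_zero (x + y)
  simp only [map_add, LinearMap.add_apply, L.self_eq_zero, zero_add, add_zero] at h
  exact eq_neg_of_add_eq_zero_right h

theorem isIdeal_unimodularIdeal (L : LieBracket 𝕜 A) : L.IsIdeal L.unimodularIdeal := by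
  intro a x _
  have h : L.ad (L.ad a x) = L.ad a * L.ad x - L.ad x * L.ad a := by
    ext z
    have h1 := L.jacobi a x z
    rw [L.skew z (L.ad a x), L.skew z a, map_neg] at h1
    simp only [LinearMap.sub_apply, Module.End.mul_apply]
    rw [sub_eq_add_neg]
    exact (sub_eq_zero.mp (by rw [sub_eq_add_neg]; exact h1)).symm
  simp only [unimodularIdeal, LinearMap.mem_ker, LinearMap.comp_apply, h, map_sub]
  rw [LinearMap.trace_mul_comm, sub_self]

end Algebra

end LieBracket

/-- A bi-vector on a finite-dimensional space `E`, i.e. an element of `Λ²E`, viewed as an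
alternating bilinear form on the dual space of `E`. -/
abbrev Bivector (𝕜 E : Type*) [RCLike 𝕜] [NormedAddCommGroup E] [NormedSpace 𝕜 E] :=
  {B : LinearMap.BilinForm 𝕜 (StrongDual 𝕜 E) // B.IsAlt}

section LiePoisson

variable {𝕜 A : Type*} [RCLike 𝕜] [NormedAddCommGroup A] [NormedSpace 𝕜 A]
  [FiniteDimensional 𝕜 A]

/-- The canonical identification of `A**` with `A` (for `A` of finite dimension): it sends the
covector `ξ` on `A*` to the `a : A` with `ξ p = p a` for all `p : A*`. -/
noncomputable def ofBidual :
    StrongDual 𝕜 (StrongDual 𝕜 A) →ₗ[𝕜] A where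
  toFun ξ := (Module.evalEquiv 𝕜 A).symm
    (ξ.toLinearMap ∘ₗ (LinearMap.toContinuousLinearMap (𝕜 := 𝕜) (E := A) (F' := 𝕜)).toLinearMap)
  map_add' ξ η := by
    rw [← map_add]; rfl
  map_smul' c ξ := by
    rw [RingHom.id_apply, ← map_smul]; rfl

theorem apply_ofBidual (p : StrongDual 𝕜 A) (ξ : StrongDual 𝕜 (StrongDual 𝕜 A)) :
    p (ofBidual ξ) = ξ p := by
  have h := Module.apply_evalEquiv_symm_apply (R := 𝕜) (M := A) p.toLinearMap
    (ξ.toLinearMap ∘ₗ (LinearMap.toContinuousLinearMap (𝕜 := 𝕜) (E := A) (F' := 𝕜)).toLinearMap)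
  exact h

/-- The Lie-Poisson structure of the bracket `L` on `A*`: the elements of `A` are the linear
functions on `A*`, and `Λ(a, b)` is the function `[a, b]`, so that `Λ(a, b)(p) = p [a, b]`. -/
noncomputable def liePoisson (L : LieBracket 𝕜 A) (p : StrongDual 𝕜 A) :
    Bivector 𝕜 (StrongDual 𝕜 A) :=
  ⟨(L.ad.compl₁₂ ofBidual ofBidual).compr₂ p.toLinearMap, fun ξ => by
    simp [L.self_eq_zero]⟩

end LiePoisson

section Pairs

variable {𝕜 E : Type*} [RCLike 𝕜] [NormedAddCommGroup E] [NormedSpace 𝕜 E]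

/-- Genericity at `p` of a pair of bi-vector fields on a space `E` of dimension `3 = 2n - 1`,
`n = 2`: the power `(a Λ + b Λ₁)^(n - 1)`, which is `a Λ + b Λ₁` itself, does not vanish at `p`
for any `(a, b) ∈ ℂ² \ {0}`. -/
def IsGenericAt [Algebra 𝕜 ℂ] (Λ Λ₁ : E → Bivector 𝕜 E) (p : E) : Prop :=
  ∀ a b : ℂ, (a, b) ≠ 0 → ∃ ξ η : StrongDual 𝕜 E,
    a * algebraMap 𝕜 ℂ ((Λ p).1 ξ η) + b * algebraMap 𝕜 ℂ ((Λ₁ p).1 ξ η) ≠ 0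

/-- The `i`-th coordinate differential `dxᵢ` at `q` of a coordinate system `φ = (x₁, x₂, x₃)`. -/
noncomputable def coordDiff (φ : E → Fin 3 → 𝕜) (i : Fin 3) (q : E) : StrongDual 𝕜 E :=
  fderiv 𝕜 (fun y => φ y i) q

/-- The bi-vector field `Λ` has constant coefficients `Λ(dxᵢ, dxⱼ)` on `U` in the
coordinates `φ`. -/
def HasConstantCoeffs (Λ : E → Bivector 𝕜 E) (φ : E → Fin 3 → 𝕜) (U : Set E) : Prop :=
  ∀ i j, ∃ c : 𝕜, ∀ q ∈ U, (Λ q).1 (coordDiff φ i q) (coordDiff φ j q) = c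

/-- Flatness at `p` of a pair of bi-vector fields on a space `E` of dimension `3`: in some
coordinates around `p` (smooth if `𝕜 = ℝ`, holomorphic if `𝕜 = ℂ`), both have constant
coefficients. -/
def IsFlatAt (Λ Λ₁ : E → Bivector 𝕜 E) (p : E) : Prop :=
  ∃ φ : OpenPartialHomeomorph E (Fin 3 → 𝕜), p ∈ φ.source ∧
    ContDiffOn 𝕜 ∞ φ φ.source ∧ ContDiffOn 𝕜 ∞ φ.symm φ.target ∧
    HasConstantCoeffs Λ φ φ.source ∧ HasConstantCoeffs Λ₁ φ φ.source

/-- A pair on a dual space is generic if it is generic at some point. -/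
def IsGenericPair [Algebra 𝕜 ℂ] (Λ Λ₁ : E → Bivector 𝕜 E) : Prop :=
  ∃ p, IsGenericAt Λ Λ₁ p

/-- A pair on a dual space is flat if it is flat at every generic point. -/
def IsFlatPair [Algebra 𝕜 ℂ] (Λ Λ₁ : E → Bivector 𝕜 E) : Prop :=
  ∀ p, IsGenericAt Λ Λ₁ p → IsFlatAt Λ Λ₁ p

end Pairs

/-- `v`, a vector of the complexification of `J`, is an eigenvector of (the complexification of)
the endomorphism `f` of `J`, with some complex eigenvalue. For `𝕜 = ℂ` this is the usual notion
of eigenvector. -/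
def IsComplexEigenvector {𝕜 J : Type*} [Field 𝕜] [Algebra 𝕜 ℂ] [AddCommGroup J] [Module 𝕜 J]
    (f : Module.End 𝕜 J) (v : ℂ ⊗[𝕜] J) : Prop :=
  ∃ μ : ℂ, Module.End.HasEigenvector (f.baseChange ℂ) μ v

/-!
Both brackets vanish on `I`, so they are determined by the action of `u`: `Λ = e₀ ∧ X` and
`Λ₁ = e₀ ∧ Y` on `A*`, where `e₀` vanishes on `I` and the linear vector fields `X`, `Y` are the
transposes of `[u, ·]` and `[u, ·]₁`. Genericity at `p` means that `area (X p) (Y p) ≠ 0`,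
where `area` is the volume form contracted with `e₀`.

If a chart makes both structures constant, its Jacobian determinant `h` is an integrating factor
of both 1-forms `area (X ·)` and `area (Y ·)`. This forces `dh(e₀) = 0`, `dh(X) = -(tr X) h` and
`dh(Y) = -(tr Y) h = 0`. Hence the commutator of `X` and `Y` is also killed by `dh`, and it is
parallel to `Y` modulo `e₀`; on `I` this reads: `f g` commutes with `g`, where `f` and `g` are the
restrictions of `[u, ·]` and `[u, ·]₁`. Conversely, if `f g` commutes with `g`, then
`f g = k g + s`, so that `area (X q) (Y q) = k Q` with `Q = area q (Y q)`. The form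
`area (Y ·) / Q` is closed, the exponential of a suitable multiple of its primitive is a common
integrating factor, and the two primitives so obtained are completed to a flattening chart by a
third function that normalizes the Jacobian determinant.

Finally, for a nonzero traceless `g` in dimension two, `f g` commutes with `g` if and only if every
complex eigenvector of `g` is an eigenvector of `f`.
-/

section Planar

open Module Module.End

variable {K V : Type*} [Field K] [AddCommGroup V] [Module K V] {f g T : End K V}

theorem mul_self_eq_trace_smul_sub_det_smul (hV : finrank K V = 2) (g : End K V) :
    g * g = LinearMap.trace K V g • g - LinearMap.det g • (1 : End K V) := by
  have : Module.Finite K V := finite_of_finrank_eq_succ hV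
  have h := g.aeval_self_charpoly
  let b := finBasisOfFinrankEq K V hV
  rw [← g.charpoly_toMatrix b, Matrix.charpoly_fin_two, ← LinearMap.trace_eq_matrix_trace,
    LinearMap.det_toMatrix] at h
  simp only [map_add, map_sub, map_mul, Polynomial.aeval_X, Polynomial.aeval_C,
    Algebra.algebraMap_eq_smul_one, smul_one_mul, sq] at h
  rw [← sub_eq_zero, ← h]
  abel

theorem eq_zero_of_eq_smul_one_of_trace_eq_zero [NeZero (2 : K)] (hV : finrank K V = 2) {c : K}
    (hT : T = c • 1) (hT0 : LinearMap.trace K V T = 0) : T = 0 := by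
  have : Module.Finite K V := finite_of_finrank_eq_succ hV
  rw [hT, map_smul, LinearMap.trace_one, hV, Nat.cast_ofNat, smul_eq_mul] at hT0
  rw [hT, (mul_eq_zero.mp hT0).resolve_right two_ne_zero, zero_smul]

theorem exists_linearIndependent_pair_apply [NeZero (2 : K)] (hV : finrank K V = 2)
    (hg : LinearMap.trace K V g = 0) (hg0 : g ≠ 0) : ∃ w, LinearIndependent K ![w, g w] := by
  by_contra! h
  obtain ⟨c, hc⟩ := LinearMap.exists_eq_smul_id_of_forall_notLinearIndependent h
  exact hg0 (eq_zero_of_eq_smul_one_of_trace_eq_zero hV hc hg)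

theorem exists_eq_smul_add_smul_of_linearIndependent (hV : finrank K V = 2) {x y : V}
    (hxy : LinearIndependent K ![x, y]) (v : V) : ∃ c d : K, v = c • x + d • y := by
  have hspan := hxy.span_eq_top_of_card_eq_finrank (by simp [hV])
  rw [Matrix.range_cons_cons_empty] at hspan
  obtain ⟨c, d, h⟩ := Submodule.mem_span_pair.mp (hspan ▸ Submodule.mem_top : v ∈ _)
  exact ⟨c, d, h.symm⟩

theorem exists_eq_smul_add_smul_one_of_commute [NeZero (2 : K)] (hV : finrank K V = 2)
    (hg : LinearMap.trace K V g = 0) (hg0 : g ≠ 0) (hT : Commute T g) :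
    ∃ k s : K, T = k • g + s • 1 := by
  obtain ⟨w, hw⟩ := exists_linearIndependent_pair_apply hV hg hg0
  obtain ⟨s, k, hTw⟩ := exists_eq_smul_add_smul_of_linearIndependent hV hw (T w)
  refine ⟨k, s, LinearMap.ext fun v => ?_⟩
  obtain ⟨c, d, rfl⟩ := exists_eq_smul_add_smul_of_linearIndependent hV hw v
  have hTgw : T (g w) = g (T w) := LinearMap.congr_fun hT w
  simp only [map_add, map_smul, hTgw, hTw, LinearMap.add_apply, LinearMap.smul_apply, one_apply]
  module

-- On `ker g ≠ 0` one has `g² = 0`, so that `s = 0` in `f g = k g + s` and `ker g = range g`.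
theorem exists_hasEigenvector_of_commute_mul [NeZero (2 : K)] (hV : finrank K V = 2)
    (hg : LinearMap.trace K V g = 0) (hg0 : g ≠ 0) (hfg : Commute (f * g) g) {μ : K} {v : V}
    (hv : HasEigenvector g μ v) : ∃ ν, HasEigenvector f ν v := by
  obtain ⟨k, s, hks⟩ := exists_eq_smul_add_smul_one_of_commute hV hg hg0 hfg
  have hfg_apply (x : V) : f (g x) = k • g x + s • x := LinearMap.congr_fun hks x
  suffices ∃ ν, f v = ν • v from this.imp fun ν hν => ⟨mem_eigenspace_iff.mpr hν, hv.2⟩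
  rcases eq_or_ne μ 0 with rfl | hμ
  · have hgv : g v = 0 := by rw [hv.apply_eq_smul, zero_smul]
    have hs : s = 0 := by simpa [hgv, hv.2] using (hfg_apply v).symm
    obtain ⟨w, hw⟩ := exists_linearIndependent_pair_apply hV hg hg0
    obtain ⟨c, d, hcd⟩ := exists_eq_smul_add_smul_of_linearIndependent hV hw v
    have hggv : g (g v) = -LinearMap.det g • v := by
      simpa [hg] using LinearMap.congr_fun (mul_self_eq_trace_smul_sub_det_smul hV g) v
    have hdet : LinearMap.det g = 0 := by simpa [hgv, hv.2] using hggv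
    have hggw : g (g w) = 0 := by
      simpa [hg, hdet] using LinearMap.congr_fun (mul_self_eq_trace_smul_sub_det_smul hV g) w
    have hc : c = 0 := by simpa [hcd, hggw, show g w ≠ 0 from hw.ne_zero 1] using hgv
    refine ⟨k, ?_⟩
    rw [hcd, hc, zero_smul, zero_add, map_smul, hfg_apply, hs, zero_smul, add_zero, smul_comm]
  · have h := hfg_apply v
    rw [hv.apply_eq_smul, map_smul, smul_smul, ← add_smul] at h
    exact ⟨μ⁻¹ * (k * μ + s), by rw [mul_smul, ← h, inv_smul_smul₀ hμ]⟩

theorem commute_mul_of_forall_hasEigenvector [NeZero (2 : K)] [IsAlgClosed K]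
    (hV : finrank K V = 2) (hg : LinearMap.trace K V g = 0)
    (h : ∀ μ v, HasEigenvector g μ v → ∃ ν, HasEigenvector f ν v) : Commute (f * g) g := by
  obtain ⟨μ, hμ⟩ := IsAlgClosed.exists_eq_mul_self (-LinearMap.det g)
  have hgg : g * g = (μ * μ) • 1 := by
    rw [mul_self_eq_trace_smul_sub_det_smul hV, hg, zero_smul, zero_sub, ← hμ, neg_smul]
  have key (ν : K) (hν : ν * ν = μ * μ) : (g - ν • 1) * f * (g + ν • 1) = 0 := by
    ext w
    have hw : g ((g + ν • 1) w) = ν • (g + ν • 1) w := by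
      have : g (g w) = (ν * ν) • w := by rw [hν]; exact LinearMap.congr_fun hgg w
      simp only [LinearMap.add_apply, LinearMap.smul_apply, one_apply, map_add, map_smul, this]
      module
    obtain ⟨ρ, hρ⟩ : ∃ ρ : K, f ((g + ν • 1) w) = ρ • (g + ν • 1) w := by
      by_cases h0 : (g + ν • 1) w = 0
      · exact ⟨0, by rw [h0, map_zero, smul_zero]⟩
      · obtain ⟨ρ, hρ⟩ := h ν _ ⟨mem_eigenspace_iff.mpr hw, h0⟩
        exact ⟨ρ, hρ.apply_eq_smul⟩
    rw [mul_apply, mul_apply, hρ, map_smul, LinearMap.sub_apply, hw]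
    simp
  have h₁ := key μ rfl
  have h₂ := key (-μ) (neg_mul_neg μ μ)
  have h₃ : (2 : K) • (g * (f * g) - (μ * μ) • f) = 0 := by
    rw [← add_zero (0 : End K V), ← congrArg₂ (· + ·) h₁ h₂]
    simp only [sub_mul, mul_add, mul_assoc, smul_mul_assoc, one_mul, mul_smul_comm, mul_one]
    module
  rw [commute_iff_eq, mul_assoc, hgg, mul_smul_comm, mul_one]
  exact (sub_eq_zero.mp ((smul_eq_zero.mp h₃).resolve_left two_ne_zero)).symm

end Planar

theorem forall_isComplexEigenvector_iff_commute {𝕜 V : Type*} [Field 𝕜] [Algebra 𝕜 ℂ]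
    [AddCommGroup V] [Module 𝕜 V] (hV : Module.finrank 𝕜 V = 2) {f g : Module.End 𝕜 V}
    (hg : LinearMap.trace 𝕜 V g = 0) (hg0 : g ≠ 0) :
    (∀ v, IsComplexEigenvector g v → IsComplexEigenvector f v) ↔ Commute (f * g) g := by
  have : Module.Finite 𝕜 V := Module.finite_of_finrank_eq_succ hV
  have hinj : Function.Injective (Module.End.baseChangeHom 𝕜 ℂ V) :=
    LinearMap.baseChangeHom_injective 𝕜 V ℂ
  have hV' : Module.finrank ℂ (ℂ ⊗[𝕜] V) = 2 := by rw [Module.finrank_baseChange, hV]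
  have hg' : LinearMap.trace ℂ _ (g.baseChange ℂ) = 0 := by
    rw [LinearMap.trace_baseChange, hg, map_zero]
  have hg0' : g.baseChange ℂ ≠ 0 := (map_ne_zero_iff _ hinj).mpr hg0
  have hcomm : Commute (f.baseChange ℂ * g.baseChange ℂ) (g.baseChange ℂ) ↔ Commute (f * g) g := by
    rw [commute_iff_eq, commute_iff_eq, ← hinj.eq_iff]
    simp only [map_mul]
    rfl
  rw [← hcomm]
  refine ⟨fun h => commute_mul_of_forall_hasEigenvector hV' hg' fun μ v hv => h v ⟨μ, hv⟩, ?_⟩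
  rintro h v ⟨μ, hv⟩
  exact exists_hasEigenvector_of_commute_mul hV' hg' hg0' h hv

section AdaptedBasis

open Module

variable {K A : Type*} [Field K] [AddCommGroup A] [Module K A]

theorem exists_basis_mem_iff_repr_zero_eq_zero (hA : finrank K A = 3) {J : Submodule K A}
    (hJ : finrank K J = 2) {u : A} (hu : u ∉ J) :
    ∃ b : Basis (Fin 3) K A, b 0 = u ∧ ∀ x, x ∈ J ↔ b.repr x 0 = 0 := by
  have : Module.Finite K J := Module.finite_of_finrank_eq_succ hJ
  let e : Basis (Fin 2) K J := finBasisOfFinrankEq K J hJ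
  have hli : LinearIndependent K (Fin.cons u fun i => (e i : A) : Fin 3 → A) :=
    (e.linearIndependent.map' J.subtype J.ker_subtype).finCons fun h =>
      hu (Submodule.span_le.mpr (Set.range_subset_iff.mpr fun i => (e i).2) h)
  let b := basisOfLinearIndependentOfCardEqFinrank hli (by simp [hA])
  have hb : ⇑b = Fin.cons u fun i => (e i : A) := coe_basisOfLinearIndependentOfCardEqFinrank _ _
  have hb0 : b 0 = u := congrFun hb 0
  have hb1 : b 1 ∈ J := (congrFun hb 1).symm ▸ (e 0).2
  have hb2 : b 2 ∈ J := (congrFun hb 2).symm ▸ (e 1).2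
  refine ⟨b, hb0, fun x => ?_⟩
  conv_lhs => rw [← b.sum_repr x, Fin.sum_univ_three, add_assoc, J.add_mem_iff_left
    (J.add_mem (J.smul_mem _ hb1) (J.smul_mem _ hb2)), hb0]
  exact ⟨fun h => by_contra fun h0 => hu ((J.smul_mem_iff h0).mp h),
    fun h => h ▸ (zero_smul K u).symm ▸ J.zero_mem⟩

end AdaptedBasis

section AdBasis

variable {K A : Type*} [CommRing K] [AddCommGroup A] [Module K A] {L : LieBracket K A}
  {J : Submodule K A} {b : Module.Basis (Fin 3) K A}

theorem sub_repr_zero_smul_mem (hb : ∀ x, x ∈ J ↔ b.repr x 0 = 0) (x : A) :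
    x - b.repr x 0 • b 0 ∈ J := by
  simp [hb]

theorem eq_repr_smul_add_repr_smul_of_mem (hb : ∀ x, x ∈ J ↔ b.repr x 0 = 0) {x : A}
    (hx : x ∈ J) : x = b.repr x 1 • b 1 + b.repr x 2 • b 2 := by
  conv_lhs => rw [← b.sum_repr x, Fin.sum_univ_three, (hb x).mp hx, zero_smul, zero_add]

theorem LieBracket.ad_basis_zero_sub (x : A) :
    L.ad (b 0) (x - b.repr x 0 • b 0) = L.ad (b 0) x := by
  rw [map_sub, map_smul, L.self_eq_zero, smul_zero, sub_zero]

theorem LieBracket.IsIdeal.ad_basis_zero_mem (hJ : L.IsIdeal J)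
    (hb : ∀ x, x ∈ J ↔ b.repr x 0 = 0) (x : A) : L.ad (b 0) x ∈ J :=
  L.ad_basis_zero_sub (b := b) x ▸ hJ (b 0) _ (sub_repr_zero_smul_mem hb x)

theorem LieBracket.IsAbelianOn.ad_apply_eq (hab : L.IsAbelianOn J)
    (hb : ∀ x, x ∈ J ↔ b.repr x 0 = 0) (x y : A) :
    L.ad x y = b.repr x 0 • L.ad (b 0) y - b.repr y 0 • L.ad (b 0) x := by
  have h := hab _ (sub_repr_zero_smul_mem hb x) _ (sub_repr_zero_smul_mem hb y)
  simp only [map_sub, map_smul, LinearMap.sub_apply, LinearMap.smul_apply, L.self_eq_zero,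
    smul_zero, sub_zero, L.skew x (b 0)] at h
  rw [← sub_eq_zero, ← h]
  module

theorem LieBracket.IsAbelianOn.adRestrict_ne_zero (hab : L.IsAbelianOn J) (hJ : L.IsIdeal J)
    (hb : ∀ x, x ∈ J ↔ b.repr x 0 = 0) (hL : L.ad ≠ 0) : L.adRestrict hJ (b 0) ≠ 0 := by
  contrapose! hL
  have h0 (x : A) : L.ad (b 0) x = 0 := by
    rw [← L.ad_basis_zero_sub (b := b)]
    exact congrArg Subtype.val (LinearMap.congr_fun hL ⟨_, sub_repr_zero_smul_mem hb x⟩)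
  ext x y
  simp [hab.ad_apply_eq hb x y, h0]

theorem LieBracket.isAbelianOn_unimodularIdeal
    (hb : ∀ x, x ∈ L.unimodularIdeal ↔ b.repr x 0 = 0) : L.IsAbelianOn L.unimodularIdeal := by
  have htrace {x : A} (hx : x ∈ L.unimodularIdeal) : ∑ i, b.repr (L.ad x (b i)) i = 0 := by
    have h : LinearMap.trace K A (L.ad x) = 0 := hx
    simpa [LinearMap.trace_eq_matrix_trace K b, Matrix.trace, LinearMap.toMatrix_apply] using h
  have hb1 : b 1 ∈ L.unimodularIdeal := (hb _).mpr (by simp)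
  have hb2 : b 2 ∈ L.unimodularIdeal := (hb _).mpr (by simp)
  have hrepr (a : A) {x : A} (hx : x ∈ L.unimodularIdeal) : b.repr (L.ad a x) 0 = 0 :=
    (hb _).mp (L.isIdeal_unimodularIdeal a x hx)
  have h12 : L.ad (b 1) (b 2) = 0 := by
    have h1 := htrace hb1
    have h2 := htrace hb2
    simp only [Fin.sum_univ_three, L.skew _ (b 0), L.skew (b 2) (b 1), L.self_eq_zero, map_neg,
      map_zero, Finsupp.neg_apply, Finsupp.zero_apply, hrepr _ hb1, hrepr _ hb2, neg_zero,
      zero_add, add_zero, neg_eq_zero] at h1 h2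
    refine b.ext_elem fun i => ?_
    fin_cases i
    exacts [by simp [hrepr _ hb2], by simp [h2], by simp [h1]]
  intro x hx y hy
  rw [eq_repr_smul_add_repr_smul_of_mem hb hx, eq_repr_smul_add_repr_smul_of_mem hb hy]
  simp only [map_add, map_smul, LinearMap.add_apply, LinearMap.smul_apply, L.self_eq_zero, h12,
    L.skew (b 2) (b 1), neg_zero, smul_zero, add_zero]

end AdBasis

open ContinuousLinearMap

section IntegratingFactor

open scoped Topology

variable {𝕜 E : Type*} [RCLike 𝕜] [NormedAddCommGroup E] [NormedSpace 𝕜 E]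

variable {Ω : E →L[𝕜] E →L[𝕜] 𝕜} {X Y : E →L[𝕜] E} {h a : E → 𝕜} {h' : StrongDual 𝕜 E} {q : E}

theorem hasFDerivAt_smul_comp (hh : HasFDerivAt h h' q) :
    HasFDerivAt (fun y => h y • Ω (X y)) (h q • (Ω ∘L X) + h'.smulRight (Ω (X q))) q :=
  hh.smul (Ω ∘L X).hasFDerivAt

theorem fderiv_symmetric_of_exact_smul
    (ha : ∀ᶠ y in 𝓝 q, HasFDerivAt a (h y • Ω (X y)) y) (hh : HasFDerivAt h h' q) (v w : E) :
    h q * Ω (X v) w + h' v * Ω (X q) w = h q * Ω (X w) v + h' w * Ω (X q) v := by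
  simpa using second_derivative_symmetric_of_eventually ha (hasFDerivAt_smul_comp hh) v w

theorem fderiv_apply_eq_neg_smul_of_exact_smul (hΩ : ∀ v w, Ω v w = -Ω w v) {τ : 𝕜}
    (hX : ∀ v w, Ω (X v) w + Ω v (X w) = τ * Ω v w) (hXq : Ω (X q) ≠ 0)
    (ha : ∀ᶠ y in 𝓝 q, HasFDerivAt a (h y • Ω (X y)) y) (hh : HasFDerivAt h h' q) :
    h' (X q) = -τ * h q := by
  obtain ⟨w, hw⟩ := DFunLike.ne_iff.mp hXq
  have hself : Ω (X q) (X q) = 0 := self_eq_neg.mp (hΩ _ _)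
  refine mul_right_cancel₀ hw ?_
  linear_combination fderiv_symmetric_of_exact_smul ha hh (X q) w + h' w * hself
    + h q * hΩ (X w) (X q) - h q * hX (X q) w

theorem fderiv_apply_eq_zero_of_exact_smul (hΩ : ∀ v w, Ω v w = -Ω w v) {e : E} (hΩe : Ω e = 0)
    (hXe : X e = 0) (hXq : Ω (X q) ≠ 0)
    (ha : ∀ᶠ y in 𝓝 q, HasFDerivAt a (h y • Ω (X y)) y) (hh : HasFDerivAt h h' q) : h' e = 0 := by
  obtain ⟨w, hw⟩ := DFunLike.ne_iff.mp hXq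
  have h_right (v : E) : Ω v e = 0 := by rw [hΩ, hΩe, zero_apply, neg_zero]
  refine (mul_eq_zero.mp ?_).resolve_right hw
  simpa [hXe, h_right] using fderiv_symmetric_of_exact_smul ha hh e w

theorem fderiv_commutator_eq_zero {σ ρ : 𝕜} (hh : ContDiffAt 𝕜 2 h q)
    (hX : ∀ᶠ y in 𝓝 q, fderiv 𝕜 h y (X y) = σ * h y)
    (hY : ∀ᶠ y in 𝓝 q, fderiv 𝕜 h y (Y y) = ρ * h y) :
    fderiv 𝕜 h q (X (Y q) - Y (X q)) = 0 := by
  have hd : HasFDerivAt h (fderiv 𝕜 h q) q := (hh.differentiableAt (by simp)).hasFDerivAt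
  have hd2 : HasFDerivAt (fderiv 𝕜 h) (fderiv 𝕜 (fderiv 𝕜 h) q) q :=
    ((hh.fderiv_right (m := 1) (by norm_num)).differentiableAt (by simp)).hasFDerivAt
  have hsymm := hh.isSymmSndFDerivAt (by simp) (X q) (Y q)
  have along {Z : E →L[𝕜] E} {ν : 𝕜} (hZ : ∀ᶠ y in 𝓝 q, fderiv 𝕜 h y (Z y) = ν * h y) (v : E) :
      fderiv 𝕜 h q (Z v) + fderiv 𝕜 (fderiv 𝕜 h) q v (Z q) = ν * fderiv 𝕜 h q v := by
    have := (hd2.clm_apply Z.hasFDerivAt).congr_of_eventuallyEq (hZ.mono fun y hy => hy.symm)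
    simpa using DFunLike.congr_fun (this.unique (hd.const_mul ν)) v
  rw [map_sub]
  linear_combination along hX (Y q) - along hY (X q) + hsymm + σ * hY.self_of_nhds
    - ρ * hX.self_of_nhds

theorem bilin_apply_eq_zero_of_eventually (Ω : E →L[𝕜] E →L[𝕜] 𝕜) {S T : E →L[𝕜] E}
    (h : ∀ᶠ y in 𝓝 q, Ω (S y) (T y) = 0) (y : E) : Ω (S y) (T y) = 0 := by
  let : NormedSpace ℝ E := NormedSpace.restrictScalars ℝ 𝕜 E
  have hf : AnalyticOnNhd 𝕜 (fun y => Ω (S y) (T y)) Set.univ := fun y _ =>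
    (Ω.analyticAt_bilinear (S y, T y)).comp₂ (S.analyticAt y) (T.analyticAt y)
  exact congrFun (hf.eq_of_eventuallyEq analyticOnNhd_const h) y

theorem exists_primitive_on_ball {θ : E → StrongDual 𝕜 E} {c : E} {ε : ℝ}
    (hθ : ContDiffOn 𝕜 ∞ θ (Metric.ball c ε))
    (hsymm : ∀ q ∈ Metric.ball c ε, ∀ v w, fderiv 𝕜 θ q v w = fderiv 𝕜 θ q w v) :
    ∃ a : E → 𝕜, ContDiffOn 𝕜 ∞ a (Metric.ball c ε) ∧
      ∀ q ∈ Metric.ball c ε, HasFDerivAt a (θ q) q := by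
  let : NormedSpace ℝ E := NormedSpace.restrictScalars ℝ 𝕜 E
  have : IsScalarTower ℝ 𝕜 E := RestrictScalars.isScalarTower ℝ 𝕜 E
  have hdiff (q : E) (hq : q ∈ Metric.ball c ε) :
      HasFDerivAt θ ((fderiv 𝕜 θ q).restrictScalars ℝ) q :=
    (((hθ.contDiffAt (Metric.isOpen_ball.mem_nhds hq)).differentiableAt
      (by simp)).hasFDerivAt).restrictScalars ℝ
  obtain ⟨a, ha⟩ := (convex_ball c ε).exists_forall_hasFDerivAt_of_fderiv_symmetric (𝕜 := 𝕜)
    Metric.isOpen_ball (fun q hq => (hdiff q hq).differentiableAt.differentiableWithinAt)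
    fun q hq v w => by rw [(hdiff q hq).fderiv]; exact hsymm q hq v w
  refine ⟨a, (contDiffOn_infty_iff_fderiv_of_isOpen Metric.isOpen_ball).mpr ⟨fun q hq =>
    (ha q hq).differentiableAt.differentiableWithinAt, ?_⟩, ha⟩
  exact hθ.congr fun q hq => (ha q hq).fderiv

end IntegratingFactor

section Area

variable {𝕜 E : Type*} [RCLike 𝕜] [NormedAddCommGroup E] [NormedSpace 𝕜 E]

/-- The decomposable bi-vector `v ∧ w`. The Lie–Poisson structures to be compared have this form,
with the same constant `v` and with `w` linear in the point. -/
def wedge (v w : E) : Bivector 𝕜 E :=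
  ⟨LinearMap.mk₂ 𝕜 (fun ξ η => ξ v * η w - ξ w * η v)
    (fun _ _ _ => by simp only [add_apply]; ring)
    (fun _ _ _ => by simp only [smul_apply, smul_eq_mul]; ring)
    (fun _ _ _ => by simp only [add_apply]; ring)
    (fun _ _ _ => by simp only [smul_apply, smul_eq_mul]; ring),
    fun ξ => by rw [LinearMap.mk₂_apply, mul_comm, sub_self]⟩

theorem wedge_apply (v w : E) (ξ η : StrongDual 𝕜 E) :
    (wedge v w).1 ξ η = ξ v * η w - ξ w * η v :=
  rfl

theorem apply_eq_sum_repr_mul (B : Module.Basis (Fin 3) 𝕜 E) (ξ : StrongDual 𝕜 E) (v : E) :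
    ξ v = B.repr v 0 * ξ (B 0) + B.repr v 1 * ξ (B 1) + B.repr v 2 * ξ (B 2) := by
  conv_lhs => rw [← B.sum_repr v, Fin.sum_univ_three]
  simp only [map_add, map_smul, smul_eq_mul]

variable [FiniteDimensional 𝕜 E] (B : Module.Basis (Fin 3) 𝕜 E)

/-- The form `x₁ ∧ x₂` in the linear coordinates `(x₀, x₁, x₂)` of the basis `B`, that is, the
contraction of the volume form `x₀ ∧ x₁ ∧ x₂` with `B 0`. It turns a vector field `X` into the
1-form `area B (X ·)`, which determines the bi-vector field `B 0 ∧ X`. -/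
noncomputable def area : E →L[𝕜] E →L[𝕜] 𝕜 :=
  (B.coord 1).toContinuousLinearMap.smulRight (B.coord 2).toContinuousLinearMap -
    (B.coord 2).toContinuousLinearMap.smulRight (B.coord 1).toContinuousLinearMap

theorem area_apply (v w : E) :
    area B v w = B.repr v 1 * B.repr w 2 - B.repr v 2 * B.repr w 1 :=
  rfl

theorem area_self (v : E) : area B v v = 0 := by
  rw [area_apply, mul_comm, sub_self]

theorem area_swap (v w : E) : area B v w = -area B w v := by
  rw [area_apply, area_apply]; ring

theorem area_basis_zero : area B (B 0) = 0 := by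
  ext w
  simp [area_apply]

theorem area_apply_basis_zero (v : E) : area B v (B 0) = 0 := by
  rw [area_swap, area_basis_zero, zero_apply, neg_zero]

theorem area_mul_sub_area_mul (x y v w : E) :
    area B x v * area B y w - area B x w * area B y v = area B x y * area B v w := by
  simp only [area_apply]; ring

theorem eq_repr_zero_smul_of_area_eq_zero {v : E} (hv : area B v = 0) : v = B.repr v 0 • B 0 := by
  have h₁ : B.repr v 1 = 0 := by simpa [area_apply] using DFunLike.congr_fun hv (B 2)
  have h₂ : B.repr v 2 = 0 := by simpa [area_apply] using DFunLike.congr_fun hv (B 1)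
  conv_lhs => rw [← B.sum_repr v, Fin.sum_univ_three, h₁, h₂, zero_smul, zero_smul, add_zero,
    add_zero]

theorem area_eq_zero_of_area_eq_zero {x y v : E} (hxy : area B x y ≠ 0) (hx : area B x v = 0)
    (hy : area B y v = 0) : area B v = 0 := by
  ext w
  refine (mul_eq_zero.mp ?_).resolve_left hxy
  rw [← area_mul_sub_area_mul, hx, hy, zero_mul, mul_zero, sub_zero]

theorem cyclic_sum_wedge_mul_apply (ξ : Fin 3 → StrongDual 𝕜 E) (x v : E) :
    (wedge (B 0) x).1 (ξ 1) (ξ 2) * ξ 0 v + (wedge (B 0) x).1 (ξ 2) (ξ 0) * ξ 1 v +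
      (wedge (B 0) x).1 (ξ 0) (ξ 1) * ξ 2 v =
        (Matrix.of fun i j => ξ i (B j)).det * area B x v := by
  have hξ (i : Fin 3) (z : E) := apply_eq_sum_repr_mul B (ξ i) z
  simp only [wedge_apply, area_apply, Matrix.det_fin_three, Matrix.of_apply, hξ _ x, hξ _ v]
  ring

theorem forall_smul_wedge_add_smul_wedge_eq_zero_iff [Algebra 𝕜 ℂ] (x y : E) (a b : ℂ) :
    (∀ ξ η : StrongDual 𝕜 E, a * algebraMap 𝕜 ℂ ((wedge (B 0) x).1 ξ η) +
      b * algebraMap 𝕜 ℂ ((wedge (B 0) y).1 ξ η) = 0) ↔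
    a * algebraMap 𝕜 ℂ (B.repr x 1) + b * algebraMap 𝕜 ℂ (B.repr y 1) = 0 ∧
      a * algebraMap 𝕜 ℂ (B.repr x 2) + b * algebraMap 𝕜 ℂ (B.repr y 2) = 0 := by
  refine ⟨fun h => ?_, ?_⟩
  · have hi (i : Fin 3) := h (B.coord 0).toContinuousLinearMap (B.coord i).toContinuousLinearMap
    exact ⟨by simpa [wedge_apply] using hi 1, by simpa [wedge_apply] using hi 2⟩
  · rintro ⟨h₁, h₂⟩ ξ η
    simp only [wedge_apply, apply_eq_sum_repr_mul B _ x, apply_eq_sum_repr_mul B _ y, map_sub,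
      map_mul, map_add]
    let ζ (i : Fin 3) : ℂ := algebraMap 𝕜 ℂ (ξ (B 0)) * algebraMap 𝕜 ℂ (η (B i)) -
      algebraMap 𝕜 ℂ (ξ (B i)) * algebraMap 𝕜 ℂ (η (B 0))
    linear_combination ζ 1 * h₁ + ζ 2 * h₂

theorem isGenericAt_iff_area_ne_zero [Algebra 𝕜 ℂ] {Λ Λ₁ : E → Bivector 𝕜 E} {p x y : E}
    (hΛ : Λ p = wedge (B 0) x) (hΛ₁ : Λ₁ p = wedge (B 0) y) :
    IsGenericAt Λ Λ₁ p ↔ area B x y ≠ 0 := by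
  let M : Matrix (Fin 2) (Fin 2) 𝕜 := !![B.repr x 1, B.repr x 2; B.repr y 1, B.repr y 2]
  have hdet : (M.map (algebraMap 𝕜 ℂ)).det = algebraMap 𝕜 ℂ (area B x y) := by
    rw [← RingHom.mapMatrix_apply, ← RingHom.map_det, Matrix.det_fin_two_of, area_apply]
  have hM (a b : ℂ) := forall_smul_wedge_add_smul_wedge_eq_zero_iff B x y a b
  rw [← map_ne_zero_iff _ (algebraMap 𝕜 ℂ).injective, ← hdet, ne_eq,
    ← Matrix.exists_vecMul_eq_zero_iff, IsGenericAt, hΛ, hΛ₁]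
  refine ⟨fun h hex => ?_, fun h a b hab => ?_⟩
  · obtain ⟨c, hc, hcM⟩ := hex
    obtain ⟨ξ, η, hne⟩ := h (c 0) (c 1) fun hc0 => hc (by
      ext i; fin_cases i; exacts [congrArg Prod.fst hc0, congrArg Prod.snd hc0])
    exact hne ((hM _ _).mpr ⟨by simpa [M, Matrix.vecMul_eq_sum] using congrFun hcM 0,
      by simpa [M, Matrix.vecMul_eq_sum] using congrFun hcM 1⟩ ξ η)
  · by_contra! hall
    obtain ⟨h₁, h₂⟩ := (hM a b).mp hall
    refine h ⟨![a, b], fun hc => hab ?_, ?_⟩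
    · exact Prod.ext (congrFun hc 0) (congrFun hc 1)
    · ext i
      fin_cases i
      · simpa [M, Matrix.vecMul_eq_sum] using h₁
      · simpa [M, Matrix.vecMul_eq_sum] using h₂

theorem area_mul_apply_of_apply_basis_zero {ξ : StrongDual 𝕜 E} (hξ : ξ (B 0) = 0) (x y v : E) :
    area B x y * ξ v = area B v y * ξ x + area B x v * ξ y := by
  simp only [apply_eq_sum_repr_mul B ξ v, apply_eq_sum_repr_mul B ξ x, apply_eq_sum_repr_mul B ξ y,
    hξ, area_apply]
  ring

theorem area_apply_add_area_apply {X : E →L[𝕜] E} (hX : X (B 0) = 0) (v w : E) :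
    area B (X v) w + area B v (X w) = LinearMap.trace 𝕜 E X * area B v w := by
  have hrepr (z : E) (i : Fin 3) :
      B.repr (X z) i = B.repr z 1 * B.repr (X (B 1)) i + B.repr z 2 * B.repr (X (B 2)) i := by
    conv_lhs => rw [← B.sum_repr z, Fin.sum_univ_three]
    simp [hX]
  rw [LinearMap.trace_eq_matrix_trace 𝕜 B, Matrix.trace_fin_three]
  simp only [area_apply, LinearMap.toMatrix_apply, coe_coe, hX, map_zero, Finsupp.zero_apply,
    hrepr v, hrepr w]
  ring

end Area

section Obstruction

variable {𝕜 E : Type*} [RCLike 𝕜] [NormedAddCommGroup E] [NormedSpace 𝕜 E]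
  (B : Module.Basis (Fin 3) 𝕜 E)

/-- The Jacobian determinant `det (∂xᵢ/∂Bⱼ)` at `q` of a coordinate system `φ = (x₁, x₂, x₃)`
with respect to the linear coordinates of the basis `B`. It is the integrating factor provided by a
flattening chart. -/
noncomputable def jacobianDet (φ : E → Fin 3 → 𝕜) (q : E) : 𝕜 :=
  (Matrix.of fun i j => coordDiff φ i q (B j)).det

theorem contDiffAt_jacobianDet {φ : E → Fin 3 → 𝕜} {q : E} (hφ : ContDiffAt 𝕜 ∞ φ q) :
    ContDiffAt 𝕜 ∞ (jacobianDet B φ) q := by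
  have hentry (i j : Fin 3) : ContDiffAt 𝕜 ∞ (fun y => coordDiff φ i y (B j)) q :=
    ((contDiffAt_pi.mp hφ i).fderiv_right (m := ∞) (by simp)).clm_apply contDiffAt_const
  unfold jacobianDet
  simp only [Matrix.det_apply]
  exact ContDiffAt.sum fun σ _ => (contDiffAt_prod fun i _ => hentry _ _).const_smul _

theorem jacobianDet_ne_zero (φ : OpenPartialHomeomorph E (Fin 3 → 𝕜)) {q : E}
    (hq : q ∈ φ.source) (hφ : DifferentiableAt 𝕜 φ q) (hφ' : DifferentiableAt 𝕜 φ.symm (φ q)) :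
    jacobianDet B φ q ≠ 0 := by
  let P : Module.Basis (Fin 3) 𝕜 (Fin 3 → 𝕜) := Pi.basisFun 𝕜 (Fin 3)
  have hcomp : fderiv 𝕜 φ.symm (φ q) ∘L fderiv 𝕜 φ q = .id 𝕜 E :=
    (hφ'.hasFDerivAt.comp q hφ.hasFDerivAt).unique
      ((hasFDerivAt_id q).congr_of_eventuallyEq (φ.eventually_left_inverse hq))
  have hmatrix : (Matrix.of fun i j => coordDiff φ i q (B j)) =
      LinearMap.toMatrix B P (fderiv 𝕜 φ q).toLinearMap := by
    ext i j
    simp [P, LinearMap.toMatrix_apply, coordDiff, fderiv_apply hφ]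
  rw [jacobianDet, hmatrix]
  refine Matrix.det_ne_zero_of_left_inverse
    (B := LinearMap.toMatrix P B (fderiv 𝕜 φ.symm (φ q)).toLinearMap) ?_
  rw [← LinearMap.toMatrix_comp, ← toLinearMap_comp, hcomp,
    coe_id, LinearMap.toMatrix_id]

variable [FiniteDimensional 𝕜 E]

theorem exists_hasFDerivAt_smul_area_of_hasConstantCoeffs {Λ : E → Bivector 𝕜 E} {X : E → E}
    (hΛ : ∀ q, Λ q = wedge (B 0) (X q)) {φ : E → Fin 3 → 𝕜} {U : Set E}
    (hφ : ∀ q ∈ U, DifferentiableAt 𝕜 φ q) (hc : HasConstantCoeffs Λ φ U) :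
    ∃ a : E → 𝕜, ∀ q ∈ U, HasFDerivAt a (jacobianDet B φ q • area B (X q)) q := by
  choose c hc using hc
  refine ⟨fun y => c 1 2 * φ y 0 + c 2 0 * φ y 1 + c 0 1 * φ y 2, fun q hq => ?_⟩
  have hφi (i : Fin 3) : HasFDerivAt (fun y => φ y i) (coordDiff φ i q) q :=
    (differentiableAt_pi.mp (hφ q hq) i).hasFDerivAt
  refine ((((hφi 0).const_mul (c 1 2)).fun_add ((hφi 1).const_mul (c 2 0))).fun_add
    ((hφi 2).const_mul (c 0 1))).congr_fderiv ?_
  ext v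
  simp only [add_apply, smul_apply, smul_eq_mul, jacobianDet, ← cyclic_sum_wedge_mul_apply,
    ← hc _ _ q hq, hΛ]

variable {X Y : E →L[𝕜] E}

theorem area_commutator_eq_zero_of_exact_smul (hX : X (B 0) = 0) (hY : Y (B 0) = 0)
    (hτ : LinearMap.trace 𝕜 E X ≠ 0) (hY0 : LinearMap.trace 𝕜 E Y = 0) {U : Set E} (hU : IsOpen U)
    {h a b : E → 𝕜} (hh : ∀ q ∈ U, ContDiffAt 𝕜 2 h q) (hh0 : ∀ q ∈ U, h q ≠ 0)
    (ha : ∀ q ∈ U, HasFDerivAt a (h q • area B (X q)) q)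
    (hb : ∀ q ∈ U, HasFDerivAt b (h q • area B (Y q)) q)
    (hXY : ∀ q ∈ U, area B (X q) (Y q) ≠ 0) {q : E} (hq : q ∈ U) :
    area B (X (Y q) - Y (X q)) (Y q) = 0 := by
  have hXne {y : E} (hy : y ∈ U) : area B (X y) ≠ 0 := fun h0 => hXY y hy (by simp [h0])
  have hYne {y : E} (hy : y ∈ U) : area B (Y y) ≠ 0 := fun h0 =>
    hXY y hy (by simp [area_swap B (X y), h0])
  have hd {y : E} (hy : y ∈ U) : HasFDerivAt h (fderiv 𝕜 h y) y :=
    ((hh y hy).differentiableAt (by simp)).hasFDerivAt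
  have ha' {y : E} (hy : y ∈ U) := Filter.eventually_of_mem (hU.mem_nhds hy) ha
  have hb' {y : E} (hy : y ∈ U) := Filter.eventually_of_mem (hU.mem_nhds hy) hb
  have hdX : ∀ y ∈ U, fderiv 𝕜 h y (X y) = -LinearMap.trace 𝕜 E X * h y := fun y hy =>
    fderiv_apply_eq_neg_smul_of_exact_smul (area_swap B) (area_apply_add_area_apply B hX)
      (hXne hy) (ha' hy) (hd hy)
  have hdY : ∀ y ∈ U, fderiv 𝕜 h y (Y y) = -LinearMap.trace 𝕜 E Y * h y := fun y hy =>
    fderiv_apply_eq_neg_smul_of_exact_smul (area_swap B) (area_apply_add_area_apply B hY)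
      (hYne hy) (hb' hy) (hd hy)
  have hde : fderiv 𝕜 h q (B 0) = 0 :=
    fderiv_apply_eq_zero_of_exact_smul (area_swap B) (area_basis_zero B) hX (hXne hq) (ha' hq)
      (hd hq)
  have hdXY : fderiv 𝕜 h q (X (Y q) - Y (X q)) = 0 :=
    fderiv_commutator_eq_zero (hh q hq) (Filter.eventually_of_mem (hU.mem_nhds hq) hdX)
      (Filter.eventually_of_mem (hU.mem_nhds hq) hdY)
  have harea := area_mul_apply_of_apply_basis_zero B hde (X (Y q) - Y (X q)) (Y q) (X q)
  rw [hdXY, hdY q hq, hdX q hq, hY0, neg_zero, zero_mul, mul_zero, mul_zero, add_zero] at harea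
  exact (mul_eq_zero.mp harea).resolve_right (mul_ne_zero (neg_ne_zero.mpr hτ) (hh0 q hq))

theorem IsFlatAt.area_commutator_eq_zero {Λ Λ₁ : E → Bivector 𝕜 E} {p : E}
    (hflat : IsFlatAt Λ Λ₁ p) (hΛ : ∀ q, Λ q = wedge (B 0) (X q))
    (hΛ₁ : ∀ q, Λ₁ q = wedge (B 0) (Y q)) (hX : X (B 0) = 0) (hY : Y (B 0) = 0)
    (hτ : LinearMap.trace 𝕜 E X ≠ 0) (hY0 : LinearMap.trace 𝕜 E Y = 0)
    (hp : area B (X p) (Y p) ≠ 0) (q : E) : area B (X (Y q) - Y (X q)) (Y q) = 0 := by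
  obtain ⟨φ, hpφ, hφ, hφ', hc, hc₁⟩ := hflat
  have hφq {y : E} (hy : y ∈ φ.source) : ContDiffAt 𝕜 ∞ φ y :=
    hφ.contDiffAt (φ.open_source.mem_nhds hy)
  have hdφ {y : E} (hy : y ∈ φ.source) : DifferentiableAt 𝕜 φ y :=
    (hφq hy).differentiableAt (by simp)
  have hdφ' {y : E} (hy : y ∈ φ.source) : DifferentiableAt 𝕜 φ.symm (φ y) :=
    (hφ'.contDiffAt (φ.open_target.mem_nhds (φ.map_source hy))).differentiableAt (by simp)
  obtain ⟨a, ha⟩ := exists_hasFDerivAt_smul_area_of_hasConstantCoeffs B hΛ (fun _ => hdφ) hc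
  obtain ⟨b, hb⟩ := exists_hasFDerivAt_smul_area_of_hasConstantCoeffs B hΛ₁ (fun _ => hdφ) hc₁
  have hopen : IsOpen {y | area B (X y) (Y y) ≠ 0} :=
    isOpen_ne_fun (by fun_prop) continuous_const
  have hU := φ.open_source.inter hopen
  refine bilin_apply_eq_zero_of_eventually (q := p) (area B) (S := X ∘L Y - Y ∘L X) ?_ q
  filter_upwards [hU.mem_nhds ⟨hpφ, hp⟩] with y hy
  exact area_commutator_eq_zero_of_exact_smul B hX hY hτ hY0 hU
    (fun z hz => (contDiffAt_jacobianDet B (hφq hz.1)).of_le (by norm_cast))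
    (fun z hz => jacobianDet_ne_zero B φ hz.1 (hdφ hz.1) (hdφ' hz.1))
    (fun z hz => ha z hz.1) (fun z hz => hb z hz.1) (fun z hz => hz.2) hy

end Obstruction

section Straightening

variable {𝕜 E : Type*} [RCLike 𝕜] [NormedAddCommGroup E] [NormedSpace 𝕜 E]

theorem exists_openPartialHomeomorph_of_injective_fderiv [FiniteDimensional 𝕜 E]
    (hE : Module.finrank 𝕜 E = 3) {U : Set E} (hU : IsOpen U) {p : E} (hp : p ∈ U)
    {F : E → Fin 3 → 𝕜} (hF : ContDiffOn 𝕜 ∞ F U)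
    (hinj : ∀ q ∈ U, Function.Injective (fderiv 𝕜 F q)) :
    ∃ φ : OpenPartialHomeomorph E (Fin 3 → 𝕜), (φ : E → Fin 3 → 𝕜) = F ∧ p ∈ φ.source ∧
      φ.source ⊆ U ∧ ContDiffOn 𝕜 ∞ φ φ.source ∧ ContDiffOn 𝕜 ∞ φ.symm φ.target := by
  have : CompleteSpace E := FiniteDimensional.complete 𝕜 E
  have hF' (q : E) (hq : q ∈ U) : ContDiffAt 𝕜 ∞ F q := hF.contDiffAt (hU.mem_nhds hq)
  have hequiv (q : E) (hq : q ∈ U) :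
      ∃ e : E ≃L[𝕜] (Fin 3 → 𝕜), HasFDerivAt F (e : E →L[𝕜] Fin 3 → 𝕜) q :=
    ⟨(LinearEquiv.ofInjectiveOfFinrankEq (fderiv 𝕜 F q).toLinearMap (hinj q hq)
      (by simp [hE])).toContinuousLinearEquiv,
      ((hF' q hq).differentiableAt (by simp)).hasFDerivAt⟩
  obtain ⟨e, he⟩ := hequiv p hp
  let ψ := ((hF' p hp).toOpenPartialHomeomorph F he (by simp)).restrOpen U hU
  refine ⟨ψ, rfl, ⟨(hF' p hp).mem_toOpenPartialHomeomorph_source he (by simp), hp⟩,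
    fun q hq => hq.2, hF.mono fun q hq => hq.2, fun y hy => ?_⟩
  have hs := ψ.map_target hy
  obtain ⟨e', he'⟩ := hequiv _ hs.2
  exact (ψ.contDiffAt_symm hy he' (hF' _ hs.2)).contDiffWithinAt

theorem hasConstantCoeffs_of_coordDiff_mul_eq {Λ : E → Bivector 𝕜 E} {e : E} {X : E → E}
    (hΛ : ∀ q, Λ q = wedge e (X q)) {φ : E → Fin 3 → 𝕜} {U : Set E} {c₀ c₁ : 𝕜}
    (he₀ : ∀ q ∈ U, coordDiff φ 0 q e = 0) (he₁ : ∀ q ∈ U, coordDiff φ 1 q e = 0)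
    (hc₀ : ∀ q ∈ U, coordDiff φ 2 q e * coordDiff φ 0 q (X q) = c₀)
    (hc₁ : ∀ q ∈ U, coordDiff φ 2 q e * coordDiff φ 1 q (X q) = c₁) :
    HasConstantCoeffs Λ φ U := by
  refine fun i j => ⟨!![0, 0, -c₀; 0, 0, -c₁; c₀, c₁, 0] i j, fun q hq => ?_⟩
  rw [hΛ, wedge_apply]
  fin_cases i <;> fin_cases j <;>
    simp [he₀ q hq, he₁ q hq, ← hc₀ q hq, ← hc₁ q hq, mul_comm]

variable (B : Module.Basis (Fin 3) 𝕜 E) [FiniteDimensional 𝕜 E]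

theorem exists_fderiv_basis_zero_mul_eq_one {U : Set E} (hU : IsOpen U) {m : E → 𝕜}
    (hm : ContDiffOn 𝕜 ∞ m U) (hm0 : ∀ q ∈ U, m q ≠ 0)
    (hme : ∀ q ∈ U, fderiv 𝕜 m q (B 0) = 0) :
    ∃ z : E → 𝕜, ContDiffOn 𝕜 ∞ z U ∧ ∀ q ∈ U, fderiv 𝕜 z q (B 0) * m q = 1 := by
  let x₀ : StrongDual 𝕜 E := (B.coord 0).toContinuousLinearMap
  refine ⟨fun q => x₀ q * (m q)⁻¹, x₀.contDiff.contDiffOn.mul (hm.inv hm0), fun q hq => ?_⟩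
  have hd : HasFDerivAt m (fderiv 𝕜 m q) q :=
    ((hm.contDiffAt (hU.mem_nhds hq)).differentiableAt (by simp)).hasFDerivAt
  have hz := x₀.hasFDerivAt.fun_mul ((hasDerivAt_inv (hm0 q hq)).comp_hasFDerivAt q hd)
  simp only [Function.comp_apply] at hz
  rw [hz.fderiv]
  simp [hme q hq, x₀, hm0 q hq]

theorem injective_fderiv_of_coordDiff_eq_smul_area {F : E → Fin 3 → 𝕜} {x y q : E} {c : 𝕜}
    (hF : DifferentiableAt 𝕜 F q) (h₀ : coordDiff F 0 q = c • area B x)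
    (h₁ : coordDiff F 1 q = c • area B y) (hc : c ≠ 0) (hxy : area B x y ≠ 0)
    (h₂ : coordDiff F 2 q (B 0) ≠ 0) : Function.Injective (fderiv 𝕜 F q) := by
  rw [injective_iff_map_eq_zero]
  intro v hv
  have hFv (i : Fin 3) : coordDiff F i q v = 0 := by
    rw [coordDiff, fderiv_apply hF]
    exact congrFun hv i
  have hx : area B x v = 0 := by simpa [h₀, hc] using hFv 0
  have hy : area B y v = 0 := by simpa [h₁, hc] using hFv 1
  have hv0 := eq_repr_zero_smul_of_area_eq_zero B (area_eq_zero_of_area_eq_zero B hxy hx hy)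
  have hz := hFv 2
  rw [hv0, map_smul, smul_eq_mul] at hz
  rw [hv0, (mul_eq_zero.mp hz).resolve_right h₂, zero_smul]

variable {B} {X Y : E →L[𝕜] E}

theorem exists_fderiv_basis_zero_mul_smul_area_eq_one (hX : X (B 0) = 0) (hY : Y (B 0) = 0)
    {U : Set E} (hU : IsOpen U) (hXY : ∀ q ∈ U, area B (X q) (Y q) ≠ 0) {h a : E → 𝕜}
    (hh : ContDiffOn 𝕜 ∞ h U) (hh0 : ∀ q ∈ U, h q ≠ 0)
    (ha : ∀ q ∈ U, HasFDerivAt a (h q • area B (X q)) q) :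
    ∃ z : E → 𝕜, ContDiffOn 𝕜 ∞ z U ∧
      ∀ q ∈ U, fderiv 𝕜 z q (B 0) * (h q * area B (X q) (Y q)) = 1 := by
  refine exists_fderiv_basis_zero_mul_eq_one B hU (hh.mul (by fun_prop))
    (fun q hq => mul_ne_zero (hh0 q hq) (hXY q hq)) fun q hq => ?_
  have hdh : HasFDerivAt h (fderiv 𝕜 h q) q :=
    ((hh.contDiffAt (hU.mem_nhds hq)).differentiableAt (by simp)).hasFDerivAt
  have hdXY : HasFDerivAt (fun y => area B (X y) (Y y)) _ q :=
    (area B ∘L X).hasFDerivAt.clm_apply Y.hasFDerivAt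
  have hhe : fderiv 𝕜 h q (B 0) = 0 :=
    fderiv_apply_eq_zero_of_exact_smul (area_swap B) (area_basis_zero B) hX
      (fun h0 => hXY q hq (by simp [h0])) (Filter.eventually_of_mem (hU.mem_nhds hq) ha) hdh
  rw [(hdh.fun_mul hdXY).fderiv]
  simp [hX, hY, hhe]

theorem isFlatAt_of_exact_smul {Λ Λ₁ : E → Bivector 𝕜 E}
    (hΛ : ∀ q, Λ q = wedge (B 0) (X q)) (hΛ₁ : ∀ q, Λ₁ q = wedge (B 0) (Y q))
    (hX : X (B 0) = 0) (hY : Y (B 0) = 0) {U : Set E} (hU : IsOpen U) {p : E} (hp : p ∈ U)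
    (hXY : ∀ q ∈ U, area B (X q) (Y q) ≠ 0) {h a b : E → 𝕜} (hh : ContDiffOn 𝕜 ∞ h U)
    (hh0 : ∀ q ∈ U, h q ≠ 0) (ha : ContDiffOn 𝕜 ∞ a U) (hb : ContDiffOn 𝕜 ∞ b U)
    (ha' : ∀ q ∈ U, HasFDerivAt a (h q • area B (X q)) q)
    (hb' : ∀ q ∈ U, HasFDerivAt b (h q • area B (Y q)) q) : IsFlatAt Λ Λ₁ p := by
  obtain ⟨z, hz, hze⟩ := exists_fderiv_basis_zero_mul_smul_area_eq_one hX hY hU hXY hh hh0 ha'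
  let F : E → Fin 3 → 𝕜 := fun q => ![a q, b q, z q]
  have hF : ContDiffOn 𝕜 ∞ F U := contDiffOn_pi.mpr fun i => by fin_cases i; exacts [ha, hb, hz]
  have hF₀ (q : E) (hq : q ∈ U) : coordDiff F 0 q = h q • area B (X q) := (ha' q hq).fderiv
  have hF₁ (q : E) (hq : q ∈ U) : coordDiff F 1 q = h q • area B (Y q) := (hb' q hq).fderiv
  have hF₂ (q : E) (hq : q ∈ U) :
      coordDiff F 2 q (B 0) * (h q * area B (X q) (Y q)) = 1 := hze q hq
  obtain ⟨φ, hφF, hpφ, hφU, hφ, hφ'⟩ := exists_openPartialHomeomorph_of_injective_fderiv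
    (Module.finrank_eq_card_basis B) hU hp hF fun q hq =>
      injective_fderiv_of_coordDiff_eq_smul_area B
        ((hF.contDiffAt (hU.mem_nhds hq)).differentiableAt (by simp)) (hF₀ q hq) (hF₁ q hq)
        (hh0 q hq) (hXY q hq) (left_ne_zero_of_mul_eq_one (hF₂ q hq))
  have hF₀e (q : E) (hq : q ∈ φ.source) : coordDiff F 0 q (B 0) = 0 := by
    simp [hF₀ q (hφU hq), area_apply_basis_zero]
  have hF₁e (q : E) (hq : q ∈ φ.source) : coordDiff F 1 q (B 0) = 0 := by
    simp [hF₁ q (hφU hq), area_apply_basis_zero]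
  refine ⟨φ, hpφ, hφ, hφ', ?_, ?_⟩ <;> rw [hφF]
  · refine hasConstantCoeffs_of_coordDiff_mul_eq (c₀ := 0) (c₁ := -1) hΛ hF₀e hF₁e
      (fun q hq => ?_) fun q hq => ?_
    · simp [hF₀ q (hφU hq), area_self]
    · rw [hF₁ q (hφU hq), smul_apply, smul_eq_mul, area_swap]
      linear_combination -hF₂ q (hφU hq)
  · refine hasConstantCoeffs_of_coordDiff_mul_eq (c₀ := 1) (c₁ := 0) hΛ₁ hF₀e hF₁e
      (fun q hq => ?_) fun q hq => ?_
    · rw [hF₀ q (hφU hq), smul_apply, smul_eq_mul]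
      exact hF₂ q (hφU hq)
    · simp [hF₁ q (hφU hq), area_self]

theorem exists_primitive_smul_area (hX : X (B 0) = 0) {p : E} {ε : ℝ} {h c : E → 𝕜}
    (hh : ContDiffOn 𝕜 ∞ h (Metric.ball p ε))
    (hh' : ∀ q ∈ Metric.ball p ε, HasFDerivAt h (c q • area B (Y q)) q)
    (hc : ∀ q ∈ Metric.ball p ε, c q * area B (X q) (Y q) = LinearMap.trace 𝕜 E X * h q) :
    ∃ a : E → 𝕜, ContDiffOn 𝕜 ∞ a (Metric.ball p ε) ∧
      ∀ q ∈ Metric.ball p ε, HasFDerivAt a (h q • area B (X q)) q := by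
  refine exists_primitive_on_ball (hh.smul (area B ∘L X).contDiff.contDiffOn) fun q hq v w => ?_
  rw [(hasFDerivAt_smul_comp (hh' q hq)).fderiv]
  simp only [add_apply, smul_apply, smulRight_apply, comp_apply, smul_eq_mul]
  linear_combination h q * area_apply_add_area_apply B hX v w - h q * area_swap B (X w) v
    + c q * area_mul_sub_area_mul B (Y q) (X q) v w
    + c q * area B v w * area_swap B (Y q) (X q) - area B v w * hc q hq

theorem hasFDerivAt_area_self_apply (hY : Y (B 0) = 0) (hY0 : LinearMap.trace 𝕜 E Y = 0) (q : E) :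
    HasFDerivAt (fun y => area B y (Y y)) ((-2 : 𝕜) • area B (Y q)) q := by
  refine ((area B).hasFDerivAt.clm_apply Y.hasFDerivAt).congr_fderiv ?_
  ext v
  have hq := area_apply_add_area_apply B hY q v
  rw [hY0, zero_mul] at hq
  simp only [add_apply, comp_apply, flip_apply, smul_apply, smul_eq_mul]
  linear_combination hq + area_swap B v (Y q)

theorem exists_primitive_inv_smul_area (hY : Y (B 0) = 0) (hY0 : LinearMap.trace 𝕜 E Y = 0)
    {p : E} {ε : ℝ} (hQ : ∀ q ∈ Metric.ball p ε, area B q (Y q) ≠ 0) :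
    ∃ ℓ : E → 𝕜, ContDiffOn 𝕜 ∞ ℓ (Metric.ball p ε) ∧
      ∀ q ∈ Metric.ball p ε, HasFDerivAt ℓ ((area B q (Y q))⁻¹ • area B (Y q)) q := by
  have hsmooth : ContDiff 𝕜 ∞ fun q => area B q (Y q) := by fun_prop
  refine exists_primitive_smul_area (Y := Y) (c := fun q => 2 * ((area B q (Y q)) ^ 2)⁻¹) hY
    (hsmooth.contDiffOn.inv hQ) (fun q hq => ?_) fun q _ => by simp [area_self, hY0]
  refine ((hasDerivAt_inv (hQ q hq)).comp_hasFDerivAt q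
    (hasFDerivAt_area_self_apply hY hY0 q)).congr_fderiv ?_
  rw [smul_smul]
  congr 1
  ring

theorem exists_hasFDerivAt_mul_div_smul_area (hY : Y (B 0) = 0)
    (hY0 : LinearMap.trace 𝕜 E Y = 0) {p : E} {ε : ℝ}
    (hQ : ∀ q ∈ Metric.ball p ε, area B q (Y q) ≠ 0) (κ : 𝕜) :
    ∃ h : E → 𝕜, ContDiffOn 𝕜 ∞ h (Metric.ball p ε) ∧ (∀ q, h q ≠ 0) ∧
      ∀ q ∈ Metric.ball p ε, HasFDerivAt h ((κ * h q / area B q (Y q)) • area B (Y q)) q := by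
  obtain ⟨ℓ, hℓ, hℓ'⟩ := exists_primitive_inv_smul_area hY hY0 hQ
  have hexp : ContDiff 𝕜 ∞ (NormedSpace.exp : 𝕜 → 𝕜) := contDiff_iff_contDiffAt.mpr fun x =>
    (NormedSpace.exp_analytic (𝕂 := 𝕜) x).contDiffAt
  refine ⟨fun q => NormedSpace.exp (κ * ℓ q), hexp.comp_contDiffOn (contDiffOn_const.mul hℓ),
    fun q => (NormedSpace.isUnit_exp _).ne_zero, fun q hq => ?_⟩
  refine ((hasDerivAt_exp (x := κ * ℓ q)).comp_hasFDerivAt q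
    ((hℓ' q hq).const_mul κ)).congr_fderiv ?_
  rw [smul_smul, smul_smul]
  congr 1
  ring

theorem isFlatAt_of_area_eq_mul {Λ Λ₁ : E → Bivector 𝕜 E} {p : E}
    (hΛ : ∀ q, Λ q = wedge (B 0) (X q)) (hΛ₁ : ∀ q, Λ₁ q = wedge (B 0) (Y q))
    (hX : X (B 0) = 0) (hY : Y (B 0) = 0) (hY0 : LinearMap.trace 𝕜 E Y = 0) {k : 𝕜}
    (hk : ∀ q, area B (X q) (Y q) = k * area B q (Y q)) (hp : area B (X p) (Y p) ≠ 0) :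
    IsFlatAt Λ Λ₁ p := by
  have hk0 : k ≠ 0 := left_ne_zero_of_mul (hk p ▸ hp)
  have hopen : IsOpen {q | area B q (Y q) ≠ 0} := isOpen_ne_fun (by fun_prop) continuous_const
  obtain ⟨ε, hε, hQ⟩ := Metric.isOpen_iff.mp hopen p (right_ne_zero_of_mul (hk p ▸ hp))
  obtain ⟨h, hh, hh0, hh'⟩ :=
    exists_hasFDerivAt_mul_div_smul_area hY hY0 hQ (LinearMap.trace 𝕜 E X / k)
  obtain ⟨a, ha, ha'⟩ := exists_primitive_smul_area hX hh hh' fun q hq => by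
    have hQq : area B q (Y q) ≠ 0 := hQ hq
    rw [hk]
    field_simp
  obtain ⟨b, hb, hb'⟩ := exists_primitive_smul_area hY hh hh' fun q _ => by
    rw [area_self, hY0, mul_zero, zero_mul]
  exact isFlatAt_of_exact_smul hΛ hΛ₁ hX hY Metric.isOpen_ball (Metric.mem_ball_self hε)
    (fun q hq => hk q ▸ mul_ne_zero hk0 (hQ hq)) hh (fun q _ => hh0 q) ha hb ha' hb'

end Straightening

section Transpose

open Module

variable {𝕜 A : Type*} [RCLike 𝕜] [NormedAddCommGroup A] [NormedSpace 𝕜 A]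
  [FiniteDimensional 𝕜 A]

/-- The transpose of an endomorphism, acting on the dual `A*`, where the Lie–Poisson structures
live. -/
noncomputable def transpose (T : End 𝕜 A) : StrongDual 𝕜 A →L[𝕜] StrongDual 𝕜 A :=
  precomp 𝕜 (LinearMap.toContinuousLinearMap T)

theorem transpose_apply (T : End 𝕜 A) (p : StrongDual 𝕜 A) (x : A) : transpose T p x = p (T x) :=
  rfl

theorem trace_transpose (T : End 𝕜 A) :
    LinearMap.trace 𝕜 (StrongDual 𝕜 A) (transpose T) = LinearMap.trace 𝕜 A T := by
  let e : Dual 𝕜 A ≃ₗ[𝕜] StrongDual 𝕜 A := LinearMap.toContinuousLinearMap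
  rw [← LinearMap.trace_transpose' (R := 𝕜) (M := A), ← LinearMap.trace_conj' _ e]
  rfl

/-- The basis dual to `b`, moved from the algebraic to the strong dual, where `area` lives. -/
noncomputable def strongDualBasis (b : Basis (Fin 3) 𝕜 A) : Basis (Fin 3) 𝕜 (StrongDual 𝕜 A) :=
  b.dualBasis.map LinearMap.toContinuousLinearMap

variable {b : Basis (Fin 3) 𝕜 A}

theorem strongDualBasis_apply (i : Fin 3) (x : A) : strongDualBasis b i x = b.repr x i := by
  simp [strongDualBasis]

theorem strongDualBasis_repr (p : StrongDual 𝕜 A) (i : Fin 3) :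
    (strongDualBasis b).repr p i = p (b i) := by
  simp [strongDualBasis]

theorem area_strongDualBasis (p q : StrongDual 𝕜 A) :
    area (strongDualBasis b) p q = p (b 1) * q (b 2) - p (b 2) * q (b 1) := by
  simp only [area_apply, strongDualBasis_repr]

theorem restrict_eq_smul_one_of_area_transpose_eq_zero {J : Submodule 𝕜 A}
    (hb : ∀ x, x ∈ J ↔ b.repr x 0 = 0) {T : End 𝕜 A} (hT : ∀ x ∈ J, T x ∈ J)
    (h : ∀ q, area (strongDualBasis b) (transpose T q) q = 0) :
    ∃ c : 𝕜, T.restrict hT = c • 1 := by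
  simp only [area_strongDualBasis, transpose_apply] at h
  have h21 : b.repr (T (b 2)) 1 = 0 := by
    simpa [strongDualBasis_apply] using h (strongDualBasis b 1)
  have h12 : b.repr (T (b 1)) 2 = 0 := by
    simpa [strongDualBasis_apply] using h (strongDualBasis b 2)
  have h11 : b.repr (T (b 1)) 1 = b.repr (T (b 2)) 2 := by
    simpa [strongDualBasis_apply, h12, h21, sub_eq_zero] using
      h (strongDualBasis b 1 + strongDualBasis b 2)
  have hTb {i : Fin 3} (hi : i ≠ 0) := eq_repr_smul_add_repr_smul_of_mem hb
    (hT (b i) ((hb _).mpr (by simp [hi])))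
  refine ⟨b.repr (T (b 1)) 1, LinearMap.ext fun x => Subtype.ext ?_⟩
  change T x = b.repr (T (b 1)) 1 • (x : A)
  conv_rhs => rw [eq_repr_smul_add_repr_smul_of_mem hb x.2]
  conv_lhs => rw [eq_repr_smul_add_repr_smul_of_mem hb x.2, map_add, map_smul, map_smul,
    hTb one_ne_zero, hTb (i := 2) (by decide), h12, h21, ← h11]
  module

theorem transpose_mul_apply (S T : End 𝕜 A) (p : StrongDual 𝕜 A) :
    transpose (S * T) p = transpose T (transpose S p) :=
  rfl

theorem transpose_sub_apply (S T : End 𝕜 A) (p : StrongDual 𝕜 A) :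
    transpose (S - T) p = transpose S p - transpose T p := by
  ext x
  simp [transpose_apply]

theorem transpose_strongDualBasis_zero {J : Submodule 𝕜 A} (hb : ∀ x, x ∈ J ↔ b.repr x 0 = 0)
    {T : End 𝕜 A} (hT : ∀ x, T x ∈ J) : transpose T (strongDualBasis b 0) = 0 := by
  ext x
  rw [transpose_apply, strongDualBasis_apply, (hb _).mp (hT x), zero_apply]

variable {J : Submodule 𝕜 A} {F G : End 𝕜 A}

theorem area_transpose_swap (hb : ∀ x, x ∈ J ↔ b.repr x 0 = 0) (hG : ∀ x, G x ∈ J)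
    (hG0 : LinearMap.trace 𝕜 A G = 0) (p q : StrongDual 𝕜 A) :
    area (strongDualBasis b) p (transpose G q) = -area (strongDualBasis b) (transpose G p) q := by
  have h := area_apply_add_area_apply (strongDualBasis b) (transpose_strongDualBasis_zero hb hG) p q
  rw [trace_transpose, hG0, zero_mul] at h
  exact eq_neg_of_add_eq_zero_right h

theorem commute_of_forall_area_commutator_eq_zero (hJ : finrank 𝕜 J = 2)
    (hb : ∀ x, x ∈ J ↔ b.repr x 0 = 0) (hF : ∀ x ∈ J, F x ∈ J) (hG : ∀ x, G x ∈ J)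
    (hG0 : LinearMap.trace 𝕜 A G = 0)
    (h : ∀ q, area (strongDualBasis b)
      (transpose F (transpose G q) - transpose G (transpose F q)) (transpose G q) = 0) :
    Commute (F.restrict hF * G.restrict fun x _ => hG x) (G.restrict fun x _ => hG x) := by
  have hT : ∀ x ∈ J, (G * F * G - F * G * G) x ∈ J := fun _ _ =>
    J.sub_mem (hG _) (hF _ (hG _))
  obtain ⟨c, hc⟩ := restrict_eq_smul_one_of_area_transpose_eq_zero hb hT fun q => by
    rw [← neg_eq_zero, ← h q, area_transpose_swap hb hG hG0]
    simp only [transpose_sub_apply, transpose_mul_apply, map_sub]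
  set f := F.restrict hF
  set g := G.restrict fun x _ => hG x
  have hfg : (G * F * G - F * G * G).restrict hT = g * (f * g) - f * g * g := rfl
  rw [hfg] at hc
  refine (sub_eq_zero.mp (eq_zero_of_eq_smul_one_of_trace_eq_zero hJ hc ?_)).symm
  rw [map_sub, LinearMap.trace_mul_comm, sub_self]

theorem area_commutator_eq_zero_of_forall_area_eq_zero (hb : ∀ x, x ∈ J ↔ b.repr x 0 = 0)
    (hG : ∀ x, G x ∈ J) (hG0 : LinearMap.trace 𝕜 A G = 0)
    (h : ∀ q, area (strongDualBasis b) (transpose F q) (transpose G q) = 0)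
    (q : StrongDual 𝕜 A) :
    area (strongDualBasis b)
      (transpose F (transpose G q) - transpose G (transpose F q)) (transpose G q) = 0 := by
  have hpolar := h (q + transpose G q)
  simp only [map_add, add_apply, h q, h (transpose G q)] at hpolar
  rw [map_sub, sub_apply]
  linear_combination hpolar - area_transpose_swap hb hG hG0 (transpose F q) (transpose G q)

theorem exists_area_transpose_eq_mul_of_commute (hJ : finrank 𝕜 J = 2)
    (hb : ∀ x, x ∈ J ↔ b.repr x 0 = 0) (hF : ∀ x ∈ J, F x ∈ J) (hG : ∀ x, G x ∈ J)
    (hG0 : LinearMap.trace 𝕜 A G = 0)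
    (hg0 : G.restrict (fun x (_ : x ∈ J) => hG x) ≠ 0)
    (h : Commute (F.restrict hF * G.restrict fun x _ => hG x) (G.restrict fun x _ => hG x)) :
    ∃ k : 𝕜, ∀ q, area (strongDualBasis b) (transpose F q) (transpose G q) =
      k * area (strongDualBasis b) q (transpose G q) := by
  have hg : LinearMap.trace 𝕜 J (G.restrict fun x _ => hG x) = 0 := by
    rw [LinearMap.trace_restrict_eq_of_forall_mem J G hG, hG0]
  obtain ⟨k, s, hks⟩ := exists_eq_smul_add_smul_one_of_commute hJ hg hg0 h
  have hFG {i : Fin 3} (hi : i ≠ 0) : F (G (b i)) = k • G (b i) + s • b i :=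
    congrArg Subtype.val (LinearMap.congr_fun hks ⟨b i, (hb _).mpr (by simp [hi])⟩)
  refine ⟨k, fun q => ?_⟩
  rw [area_transpose_swap hb hG hG0, ← transpose_mul_apply]
  simp only [area_strongDualBasis, transpose_apply, End.mul_apply, hFG one_ne_zero,
    hFG (i := 2) (by decide), map_add, map_smul, smul_eq_mul]
  ring

end Transpose

section NormalForm

variable {𝕜 A : Type*} [RCLike 𝕜] [NormedAddCommGroup A] [NormedSpace 𝕜 A]
  [FiniteDimensional 𝕜 A] {L L₁ : LieBracket 𝕜 A} {J : Submodule 𝕜 A}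
  {b : Module.Basis (Fin 3) 𝕜 A}

theorem liePoisson_eq_wedge (hab : L.IsAbelianOn J) (hb : ∀ x, x ∈ J ↔ b.repr x 0 = 0)
    (p : StrongDual 𝕜 A) :
    liePoisson L p = wedge (strongDualBasis b 0) (transpose (L.ad (b 0)) p) := by
  ext ξ η
  change p (L.ad (ofBidual ξ) (ofBidual η)) = _
  rw [hab.ad_apply_eq hb, wedge_apply, ← apply_ofBidual _ ξ, ← apply_ofBidual _ ξ,
    ← apply_ofBidual _ η, ← apply_ofBidual _ η]
  simp only [strongDualBasis_apply, transpose_apply, map_sub, map_smul, smul_eq_mul]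
  ring

theorem isGenericPair_and_not_isFlatPair_iff [Algebra 𝕜 ℂ] (hdim : Module.finrank 𝕜 J = 2)
    (hJ : L.IsIdeal J) (hJ₁ : L₁.IsIdeal J) (hab : L.IsAbelianOn J) (hab₁ : L₁.IsAbelianOn J)
    (hb : ∀ x, x ∈ J ↔ b.repr x 0 = 0) (hτ : LinearMap.trace 𝕜 A (L.ad (b 0)) ≠ 0)
    (hτ₁ : LinearMap.trace 𝕜 A (L₁.ad (b 0)) = 0) (hL₁ : L₁.ad ≠ 0) :
    (IsGenericPair (liePoisson L) (liePoisson L₁) ∧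
        ¬ IsFlatPair (liePoisson L) (liePoisson L₁)) ↔
      ¬ Commute (L.adRestrict hJ (b 0) * L₁.adRestrict hJ₁ (b 0)) (L₁.adRestrict hJ₁ (b 0)) := by
  have hF := hJ.ad_basis_zero_mem hb
  have hG := hJ₁.ad_basis_zero_mem hb
  have hX := transpose_strongDualBasis_zero hb hF
  have hY := transpose_strongDualBasis_zero hb hG
  have hΛ := liePoisson_eq_wedge hab hb
  have hΛ₁ := liePoisson_eq_wedge hab₁ hb
  have hgen (p) := isGenericAt_iff_area_ne_zero (strongDualBasis b) (hΛ p) (hΛ₁ p)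
  constructor
  · rintro ⟨-, hflat⟩ hcomm
    obtain ⟨k, hk⟩ := exists_area_transpose_eq_mul_of_commute hdim hb (hJ (b 0)) hG hτ₁
      (hab₁.adRestrict_ne_zero hJ₁ hb hL₁) hcomm
    exact hflat fun p hp => isFlatAt_of_area_eq_mul hΛ hΛ₁ hX hY ((trace_transpose _).trans hτ₁) hk
      ((hgen p).mp hp)
  · intro hcomm
    have hgeneric : IsGenericPair (liePoisson L) (liePoisson L₁) := by
      by_contra! hnongen
      refine hcomm (commute_of_forall_area_commutator_eq_zero hdim hb (hJ (b 0)) hG hτ₁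
        (area_commutator_eq_zero_of_forall_area_eq_zero hb hG hτ₁ fun q => ?_))
      by_contra hq
      exact hnongen ⟨q, (hgen q).mpr hq⟩
    obtain ⟨p, hp⟩ := hgeneric
    refine ⟨⟨p, hp⟩, fun hflat => hcomm ?_⟩
    exact commute_of_forall_area_commutator_eq_zero hdim hb (hJ (b 0)) hG hτ₁
      ((hflat p hp).area_commutator_eq_zero (strongDualBasis b) hΛ hΛ₁ hX hY
        ((trace_transpose _).trans_ne hτ) ((trace_transpose _).trans hτ₁) ((hgen p).mp hp))

end NormalForm

theorem proposition9 {𝕜 A : Type*} [RCLike 𝕜] [Algebra 𝕜 ℂ] [IsScalarTower ℝ 𝕜 ℂ]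
    [NormedAddCommGroup A] [NormedSpace 𝕜 A] [FiniteDimensional 𝕜 A]
    (hA : Module.finrank 𝕜 A = 3)
    (L L₁ : LieBracket 𝕜 A)
    (hL : ¬ L.IsUnimodular)
    (hL₁ : L₁.IsUnimodular) (hL₁0 : L₁.ad ≠ 0)
    (hI : L₁.IsIdeal L.unimodularIdeal) (hIab : L₁.IsAbelianOn L.unimodularIdeal)
    (u : A) (hu : u ∉ L.unimodularIdeal) :
    (IsGenericPair (liePoisson L) (liePoisson L₁) ∧
        ¬ IsFlatPair (liePoisson L) (liePoisson L₁)) ↔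
      ∃ v : ℂ ⊗[𝕜] L.unimodularIdeal,
        IsComplexEigenvector (L₁.adRestrict hI u) v ∧
        ¬ IsComplexEigenvector (L.adRestrict L.isIdeal_unimodularIdeal u) v := by
  have hker : LinearMap.trace 𝕜 A ∘ₗ L.ad ≠ (0 : Module.Dual 𝕜 A) := fun h =>
    hL fun a => LinearMap.congr_fun h a
  have hdim : Module.finrank 𝕜 L.unimodularIdeal = 2 :=
    Nat.succ_injective ((Module.Dual.finrank_ker_add_one_of_ne_zero hker).trans hA)
  obtain ⟨b, rfl, hb⟩ := exists_basis_mem_iff_repr_zero_eq_zero hA hdim hu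
  have hab : L.IsAbelianOn L.unimodularIdeal := L.isAbelianOn_unimodularIdeal hb
  have htrace : LinearMap.trace 𝕜 _ (L₁.adRestrict hI (b 0)) = 0 :=
    (LinearMap.trace_restrict_eq_of_forall_mem _ _ (hI.ad_basis_zero_mem hb)).trans (hL₁ (b 0))
  rw [isGenericPair_and_not_isFlatPair_iff hdim L.isIdeal_unimodularIdeal hI hab hIab hb hu
    (hL₁ (b 0)) hL₁0, ← forall_isComplexEigenvector_iff_commute hdim htrace
    (hIab.adRestrict_ne_zero hI hb hL₁0)]
  simp only [not_forall, exists_prop]
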